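/- Consider a sequence (indexed by $n$) of finite populations. The $n$-th population is partitioned into $B=B_n$ strata; stratum $b$ has $n_b$ units, of which a fixed number $n_{b1}$, $1\le n_{b1}\le n_b-1$, is chosen uniformly at random for treatment ($z_i=1$) while the other $n_{b0}=n_b-n_{b1}$ are controls ($z_i=0$), independently across strata. Unit $i$ has a weight $w_i>0$ and fixed potential outcomes $y_{i1},y_{i0}\in\mathbb R$. Write $i\in b$ if unit $i$ belongs to stratum $b$, and $\pi_{bz}=n_{bz}/n_b$. Put $W=\sum_i w_i$, $\rho_z=W^{-1}\sum_i w_iy_{iz}$, $\theta_n=(\rho_1,\rho_0)^T$, $\tau=\rho_1-\rho_0$. The Hájek estimators are $$\hat\rho_z=\frac{\sum_b\sum_{i\in b}\mathbf 1\{z_i=z\}\,w_iy_{iz}/\pi_{bz}}{\sum_b\sum_{i\in b}\mathbf 1\{z_i=z\}\,w_i/\pi_{bz}},\qquad \hat\theta=(\hat\rho_1,\hat\rho_0)^T,\qquad \hat\tau=\hat\rho_1-\hat\rho_0 .$$ With $\gamma_{iz}=n_bw_i(y_{iz}-\rho_z)$ for $i\in b$ and $\bar\gamma_{bz}=n_b^{-1}\sum_{i\in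 b}\gamma_{iz}$, let $S_{b,z}^2=\frac1{n_b-1}\sum_{i\in b}(\gamma_{iz}-\bar\gamma_{bz})^2$, $S_{b,01}=\frac1{n_b-1}\sum_{i\in b}(\gamma_{i0}-\bar\gamma_{b0})(\gamma_{i1}-\bar\gamma_{b1})$, and $$\sigma_z^2=\frac1W\sum_b\Big(\frac1{n_{bz}}-\frac1{n_b}\Big)S_{b,z}^2,\qquad \sigma_{01}=-\frac1W\sum_b\frac{S_{b,01}}{n_b},\qquad \Sigma_n=\begin{pmatrix}\sigma_1^2&\sigma_{01}\\ \sigma_{01}&\sigma_0^2\end{pmatrix}.$$ Let $\lambda_n$ be the smallest eigenvalue of $\Sigma_n$, and let $X_b=W^{-1/2}\big(\sum_{i\in b}\mathbf 1\{z_i=1\}w_i(y_{i1}-\rho_1)/\pi_{b1},\ \sum_{i\in b}\mathbf 1\{z_i=0\}w_i(y_{i0}-\rho_0)/\pi_{b0}\big)^T$. Assume that $B\to\infty$ and that: 1. (overlap) there is a constant $c>0$ such that, for all sufficiently large $n$, $\pi_{bz}\in(c,1-c)$ for all $b$ and $z$; 2. (Kish effective sample size) $(\sum_iw_i)^2/\sum_iw_i^2\to\infty$;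 3. (nondegeneracy) there is a constant $\kappa<1$ such that, for all sufficiently large $n$, $\lambda_n>0$ and $|\sigma_{01}|\le\kappa\,\sigma_0\sigma_1$; 4. (Lindeberg) for every $\varepsilon>0$, $\lambda_n^{-1}\sum_b\mathbb E\big[\|X_b-\mathbb EX_b\|^2\,\mathbf 1\{\|X_b-\mathbb EX_b\|^2>\varepsilon\lambda_n\}\big]\to0$. Then, with $\Sigma_n^{-1/2}$ the inverse of the symmetric positive definite square root of $\Sigma_n$, $$\Sigma_n^{-1/2}\sqrt W(\hat\theta-\theta_n)\ \xrightarrow{d}\ N(0,I_2)\qquad\text{and}\qquad(\sigma_0^2-2\sigma_{01}+\sigma_1^2)^{-1/2}\sqrt W(\hat\tau-\tau)\ \xrightarrow{d}\ N(0,1).$$ -/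

import Mathlib

open MeasureTheory ProbabilityTheory Filter Topology

noncomputable section

/-- A finite population of units partitioned into strata, with two potential outcomes per unit,
randomized by complete randomization within each stratum.  Treatment arms are indexed by `Fin 2`:
`1` is treatment and `0` is control.  Stratum `b` has `size b` units, of which a fixed number
`treated b` is assigned to treatment; both arms are nonempty.  For the unit `i` of stratum `b`,
`w b i` is its weight and `y b i z` its potential outcome under arm `z`. -/
structure StratifiedExperiment where
  numStrata : ℕ
  size : Fin numStrata → ℕ
  treated : Fin numStrata → ℕ
  treated_pos : ∀ b, 0 < treated b
  treated_lt : ∀ b, treated b < size b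
  w : (b : Fin numStrata) → Fin (size b) → ℝ
  w_pos : ∀ b i, 0 < w b i
  y : (b : Fin numStrata) → Fin (size b) → Fin 2 → ℝ

/-- The possible treatment assignments of a stratum of `n` units, exactly `m` of them treated. -/
abbrev StratumAssignment (n m : ℕ) : Type :=
  {a : Fin n → Fin 2 // (Finset.univ.filter fun i => a i = 1).card = m}

theorem StratumAssignment.nonempty {n m : ℕ} (h : m ≤ n) : Nonempty (StratumAssignment n m) := by
  obtain ⟨s, -, hs⟩ := Finset.exists_subset_card_eq
    (s := (Finset.univ : Finset (Fin n))) (n := m) (by simpa using h)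
  refine ⟨⟨fun i => if i ∈ s then 1 else 0, ?_⟩⟩
  rw [← hs]
  congr 1
  ext i
  by_cases hi : i ∈ s <;> simp [hi]

namespace StratifiedExperiment

variable (E : StratifiedExperiment)

/-- A treatment assignment of the whole experiment: `ω b` is the assignment of stratum `b`. -/
abbrev Assignment : Type :=
  (b : Fin E.numStrata) → StratumAssignment (E.size b) (E.treated b)

/-- The law of the treatment assignment: uniform within each stratum, independent across strata. -/
def P : Measure E.Assignment :=
  Measure.pi fun b =>
    uniformOn (Set.univ : Set (StratumAssignment (E.size b) (E.treated b)))

instance (b : Fin E.numStrata) :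
    IsProbabilityMeasure
      (uniformOn (Set.univ : Set (StratumAssignment (E.size b) (E.treated b)))) :=
  haveI := StratumAssignment.nonempty (E.treated_lt b).le
  isProbabilityMeasure_uniformOn Set.finite_univ Set.univ_nonempty

instance : IsProbabilityMeasure E.P := by
  unfold P
  infer_instance

/-- `n_{bz}`: the number of units of stratum `b` assigned to arm `z`. -/
def armSize (b : Fin E.numStrata) (z : Fin 2) : ℕ :=
  if z = 1 then E.treated b else E.size b - E.treated b

/-- `π_{bz} = n_{bz} / n_b`. -/
def prob (b : Fin E.numStrata) (z : Fin 2) : ℝ :=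
  (E.armSize b z : ℝ) / (E.size b : ℝ)

/-- The total weight `W`. -/
def W : ℝ := ∑ b, ∑ i, E.w b i

/-- Kish's effective sample size. -/
def kishESS : ℝ := E.W ^ 2 / ∑ b, ∑ i, E.w b i ^ 2

/-- `ρ_z`: the weighted population mean of the potential outcomes under arm `z`. -/
def ρ (z : Fin 2) : ℝ := (∑ b, ∑ i, E.w b i * E.y b i z) / E.W

/-- `θ = (ρ₁, ρ₀)`. -/
def θ : EuclideanSpace ℝ (Fin 2) := !₂[E.ρ 1, E.ρ 0]

/-- The treatment effect `τ = ρ₁ - ρ₀`. -/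
def τ : ℝ := E.ρ 1 - E.ρ 0

/-- The inverse probability weight `1{zᵢ = z} / π_{bz}` of unit `i` of stratum `b`. -/
def ipw (z : Fin 2) (b : Fin E.numStrata) (i : Fin (E.size b)) (ω : E.Assignment) : ℝ :=
  if (ω b).1 i = z then (E.prob b z)⁻¹ else 0

/-- The Hájek estimator of `ρ_z`. -/
def ρHat (z : Fin 2) (ω : E.Assignment) : ℝ :=
  (∑ b, ∑ i, E.ipw z b i ω * E.w b i * E.y b i z) / ∑ b, ∑ i, E.ipw z b i ω * E.w b i

/-- `θ̂ = (ρ̂₁, ρ̂₀)`. -/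
def θHat (ω : E.Assignment) : EuclideanSpace ℝ (Fin 2) := !₂[E.ρHat 1 ω, E.ρHat 0 ω]

/-- The Hájek effect estimator `τ̂ = ρ̂₁ - ρ̂₀`. -/
def τHat (ω : E.Assignment) : ℝ := E.ρHat 1 ω - E.ρHat 0 ω

/-- `γ_{iz} = n_b wᵢ (y_{iz} - ρ_z)`. -/
def γ (z : Fin 2) (b : Fin E.numStrata) (i : Fin (E.size b)) : ℝ :=
  (E.size b : ℝ) * E.w b i * (E.y b i z - E.ρ z)

/-- The mean of `γ_{iz}` over the units of stratum `b`. -/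
def γMean (z : Fin 2) (b : Fin E.numStrata) : ℝ :=
  (∑ i, E.γ z b i) / (E.size b : ℝ)

/-- The finite population covariance of `γ_{iz}` and `γ_{iz'}` in stratum `b`; it is `S²_{b,z}`
for `z = z'` and `S_{b,01}` for `z ≠ z'`. -/
def S (b : Fin E.numStrata) (z z' : Fin 2) : ℝ :=
  (∑ i, (E.γ z b i - E.γMean z b) * (E.γ z' b i - E.γMean z' b)) / ((E.size b : ℝ) - 1)

/-- `σ_z²`. -/
def sigmaSq (z : Fin 2) : ℝ :=
  (∑ b, ((E.armSize b z : ℝ)⁻¹ - (E.size b : ℝ)⁻¹) * E.S b z z) / E.W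

/-- `σ₀₁`. -/
def sigma01 : ℝ := -(∑ b, E.S b 0 1 / (E.size b : ℝ)) / E.W

/-- The matrix `Σ_n`, with rows and columns in the order `(ρ₁, ρ₀)`. -/
def Sigma : Matrix (Fin 2) (Fin 2) ℝ :=
  !![E.sigmaSq 1, E.sigma01; E.sigma01, E.sigmaSq 0]

theorem Sigma_isHermitian : E.Sigma.IsHermitian := by
  ext i j
  fin_cases i <;> fin_cases j <;> simp [Sigma]

/-- The smallest eigenvalue of `Σ_n`. -/
def lambdaMin : ℝ := ⨅ j, E.Sigma_isHermitian.eigenvalues j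

/-- The symmetric matrix `Σ_n^{-1/2}`. -/
def SigmaInvSqrt : Matrix (Fin 2) (Fin 2) ℝ :=
  E.Sigma_isHermitian.cfc fun x => (√x)⁻¹

/-- The standardized estimator `Σ_n^{-1/2} √W (θ̂ - θ)`. -/
def standardizedθ (ω : E.Assignment) : EuclideanSpace ℝ (Fin 2) :=
  WithLp.toLp 2 (E.SigmaInvSqrt.mulVec (√E.W • (E.θHat ω - E.θ)).ofLp)

/-- The standardized effect estimator `(σ₀² - 2 σ₀₁ + σ₁²)^{-1/2} √W (τ̂ - τ)`. -/
def standardizedτ (ω : E.Assignment) : ℝ :=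
  (√(E.sigmaSq 0 - 2 * E.sigma01 + E.sigmaSq 1))⁻¹ * (√E.W * (E.τHat ω - E.τ))

/-- The contribution `X_b` of stratum `b` to `√W Φ_n(ρ₁, ρ₀)`, where `Φ_n` is the estimating
function of the Hájek estimator. -/
def X (b : Fin E.numStrata) (ω : E.Assignment) : EuclideanSpace ℝ (Fin 2) :=
  (√E.W)⁻¹ • !₂[∑ i, E.ipw 1 b i ω * E.w b i * (E.y b i 1 - E.ρ 1),
    ∑ i, E.ipw 0 b i ω * E.w b i * (E.y b i 0 - E.ρ 0)]

/-- The deviation `‖X_b - 𝔼 X_b‖²`. -/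
def devSq (b : Fin E.numStrata) (ω : E.Assignment) : ℝ :=
  ‖E.X b ω - ∫ ω', E.X b ω' ∂E.P‖ ^ 2

/-- The Lindeberg ratio
`λ_min(Σ_n)⁻¹ ∑_b 𝔼[‖X_b - 𝔼 X_b‖² 1{‖X_b - 𝔼 X_b‖² > ε λ_min(Σ_n)}]`. -/
def lindeberg (ε : ℝ) : ℝ :=
  (∑ b, ∫ ω, {ω' | ε * E.lambdaMin < E.devSq b ω'}.indicator (E.devSq b) ω ∂E.P) / E.lambdaMin

end StratifiedExperiment

end

/-! Since `∑ w (y - ρ_z) = 0`, the centered Hájek estimator is an exact ratio, `√W (ρ̂_z - ρ_z) =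
L_z / (1 + e_z)`, where `L_z` and `e_z` are mean-zero sums of independent stratum terms, linear in
the treatment indicators (`sqrt_W_mul_ρHat_sub`).

The second moment of `e_z` is at most a constant over Kish's effective sample size, so `e_z` is
negligible. The variance of `p L₁ + q L₀` is exactly the quadratic form of `Σ_n` at `(p, q)`, by the
covariance of complete randomization. If that variance is `v`, then `λ_n (p² + q²) ≤ v`, so the
assumed Lindeberg condition yields the one for `p L₁ + q L₀`. The correlation bound by `κ` keeps `p
L₁` and `q L₀` separately bounded in `L²`, so that replacing `1 + e_z` by `1` costs nothing in the
limit.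

These facts combine into an explicit bound on characteristic functions for a single population
(`norm_integral_exp_hajek_sub_le`), with a free parameter `η`; let `n → ∞`, then `η → 0`. The
coefficients may depend on `n` as long as `v` does not: `(p, q) = Σ_n^{-1/2} t` gives `v = ‖t‖²`,
and a normalized multiple of `(1, -1)` gives `v = t²`. Lévy's continuity theorem concludes. -/

/-! ### Quantitative Lindeberg theorem via characteristic functions -/

theorem norm_prod_sub_prod_le {ι R : Type*} [NormedCommRing R] [NormOneClass R] (s : Finset ι)
    (f g : ι → R) (hf : ∀ i ∈ s, ‖f i‖ ≤ 1) (hg : ∀ i ∈ s, ‖g i‖ ≤ 1) :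
    ‖∏ i ∈ s, f i - ∏ i ∈ s, g i‖ ≤ ∑ i ∈ s, ‖f i - g i‖ := by
  classical
  induction s using Finset.induction_on with
  | empty => simp
  | insert i s hi ih =>
    simp only [Finset.forall_mem_insert] at hf hg
    rw [Finset.prod_insert hi, Finset.prod_insert hi, Finset.sum_insert hi]
    have h : f i * ∏ j ∈ s, f j - g i * ∏ j ∈ s, g j
        = (f i - g i) * ∏ j ∈ s, f j + g i * (∏ j ∈ s, f j - ∏ j ∈ s, g j) := by ring
    have hs : ‖∏ j ∈ s, f j‖ ≤ 1 :=
      (Finset.norm_prod_le s f).trans (Finset.prod_le_one (fun _ _ => norm_nonneg _) hf.2)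
    rw [h]
    refine (norm_add_le _ _).trans (add_le_add ?_ ?_)
    · exact (norm_mul_le _ _).trans (mul_le_of_le_one_right (norm_nonneg _) hs)
    · exact (norm_mul_le _ _).trans
        ((mul_le_of_le_one_left (norm_nonneg _) hg.1).trans (ih hf.2 hg.2))

/-- For `|x| ≤ η` the cubic remainder `|x|³` is at most `η x²`. For larger `x` a crude multiple of
`x²` suffices: when `|x| ≥ 1`, the triangle inequality gives `2 + |x| + x²/2 ≤ 4 x²`. -/
theorem norm_exp_mul_I_sub_taylor_le {η : ℝ} (hη0 : 0 ≤ η) (hη : η ≤ 1) (x : ℝ) :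
    ‖Complex.exp (x * Complex.I) - (1 + x * Complex.I - x ^ 2 / 2)‖
      ≤ η * x ^ 2 + 4 * {y : ℝ | η ^ 2 < y ^ 2}.indicator (fun y => y ^ 2) x := by
  have hnx : ‖(x * Complex.I : ℂ)‖ = |x| := by simp
  have hsmall : |x| ≤ 1 →
      ‖Complex.exp (x * Complex.I) - (1 + x * Complex.I - x ^ 2 / 2)‖ ≤ |x| * x ^ 2 := by
    intro hx
    have h := Complex.exp_bound (x := x * Complex.I) (by rwa [hnx]) (n := 3) (by norm_num)
    rw [hnx] at h
    have hs : ∑ m ∈ Finset.range 3, (x * Complex.I : ℂ) ^ m / (m.factorial : ℂ)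
        = 1 + x * Complex.I - x ^ 2 / 2 := by
      simp [Finset.sum_range_succ, mul_pow, Nat.factorial]; ring
    rw [hs] at h
    refine h.trans ?_
    rw [← sq_abs x, show |x| * |x| ^ 2 = |x| ^ 3 by ring]
    exact mul_le_of_le_one_right (by positivity) (by norm_num [Nat.factorial])
  have hnn : 0 ≤ η * x ^ 2 := by positivity
  by_cases hx : η ^ 2 < x ^ 2
  · rw [Set.indicator_of_mem (by exact hx)]
    suffices ‖Complex.exp (x * Complex.I) - (1 + x * Complex.I - x ^ 2 / 2)‖ ≤ 4 * x ^ 2 by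
      linarith
    rcases le_total |x| 1 with h1 | h1
    · refine (hsmall h1).trans ?_
      nlinarith [sq_nonneg x]
    · have hx2 : |x| ≤ x ^ 2 := by rw [← sq_abs]; nlinarith
      calc _ ≤ ‖Complex.exp (x * Complex.I)‖ + (‖(1 : ℂ)‖ + ‖(x * Complex.I : ℂ)‖
              + ‖(x ^ 2 / 2 : ℂ)‖) := by
            refine (norm_sub_le _ _).trans (add_le_add_right ?_ _)
            exact (norm_sub_le _ _).trans (add_le_add_left (norm_add_le _ _) _)
        _ = 1 + (1 + |x| + x ^ 2 / 2) := by
            rw [Complex.norm_exp_ofReal_mul_I, hnx]; simp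
        _ ≤ _ := by linarith
  · rw [Set.indicator_of_notMem (by exact hx)]
    have hle : |x| ≤ η := abs_le_of_sq_le_sq (not_lt.1 hx) hη0
    refine (hsmall (hle.trans hη)).trans ?_
    nlinarith [sq_nonneg x]

theorem abs_exp_neg_sub_one_sub_le {u : ℝ} (hu : 0 ≤ u) : |Real.exp (-u) - (1 - u)| ≤ u ^ 2 := by
  rw [abs_le]
  constructor
  · nlinarith [Real.one_sub_le_exp_neg u]
  · have h1 : Real.exp (-u) ≤ (1 + u)⁻¹ := by
      rw [Real.exp_neg]
      exact inv_anti₀ (by linarith) (by linarith [Real.add_one_le_exp u])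
    have h2 : (1 + u)⁻¹ ≤ 1 - u + u ^ 2 := by
      rw [inv_le_iff_one_le_mul₀ (by linarith)]
      nlinarith [pow_nonneg hu 3]
    linarith

section Lindeberg

variable {Ω : Type*} [MeasurableSpace Ω] {μ : Measure Ω} [IsProbabilityMeasure μ]

theorem norm_integral_exp_sub_le {ξ : Ω → ℝ} (hξ : MemLp ξ 2 μ) (h0 : ∫ ω, ξ ω ∂μ = 0)
    {η : ℝ} (hη0 : 0 ≤ η) (hη : η ≤ 1) :
    ‖∫ ω, Complex.exp (ξ ω * Complex.I) ∂μ - (1 - (∫ ω, ξ ω ^ 2 ∂μ : ℝ) / 2)‖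
      ≤ η * ∫ ω, ξ ω ^ 2 ∂μ
        + 4 * ∫ ω, {y : ℝ | η ^ 2 < y ^ 2}.indicator (fun y => y ^ 2) (ξ ω) ∂μ := by
  have hm := hξ.aestronglyMeasurable.aemeasurable
  have hi1 : Integrable ξ μ := hξ.integrable (by norm_num)
  have hi2 : Integrable (fun ω => ξ ω ^ 2) μ := hξ.integrable_sq
  have hind : Measurable ({y : ℝ | η ^ 2 < y ^ 2}.indicator (fun y => y ^ 2)) :=
    (measurable_id.pow_const 2).indicator (measurableSet_lt measurable_const (by fun_prop))
  have hi3 : Integrable (fun ω => {y : ℝ | η ^ 2 < y ^ 2}.indicator (fun y => y ^ 2) (ξ ω)) μ := by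
    refine hi2.mono' (hind.comp_aemeasurable hm).aestronglyMeasurable (.of_forall fun ω => ?_)
    rw [Real.norm_of_nonneg (Set.indicator_nonneg (fun y _ => sq_nonneg y) _)]
    exact Set.indicator_le_self' (fun y _ => sq_nonneg y) _
  have hi4 : Integrable (fun ω => Complex.exp (ξ ω * Complex.I)) μ := by
    refine (integrable_const (1 : ℝ)).mono' (by fun_prop) (.of_forall fun ω => ?_)
    rw [Complex.norm_exp_ofReal_mul_I]
  have hi5 : Integrable (fun ω => (1 + ξ ω * Complex.I : ℂ)) μ :=
    (integrable_const _).add (hi1.ofReal.mul_const _)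
  have hi6 : Integrable (fun ω => ((ξ ω : ℂ) ^ 2 / 2 : ℂ)) μ := by
    simpa using (hi2.ofReal (𝕜 := ℂ)).div_const 2
  have he : ∫ ω, (1 + ξ ω * Complex.I - (ξ ω : ℂ) ^ 2 / 2 : ℂ) ∂μ
      = 1 - (∫ ω, ξ ω ^ 2 ∂μ : ℝ) / 2 := by
    rw [integral_sub hi5 hi6, integral_add (integrable_const _) (hi1.ofReal.mul_const _),
      integral_mul_const, integral_div, integral_complex_ofReal, h0]
    have : ∫ ω, ((ξ ω : ℂ) ^ 2) ∂μ = (∫ ω, ξ ω ^ 2 ∂μ : ℝ) := by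
      rw [← integral_complex_ofReal]; simp
    simp [this]
  have hi7 : Integrable (fun ω => (1 + ξ ω * Complex.I - (ξ ω : ℂ) ^ 2 / 2 : ℂ)) μ := hi5.sub hi6
  rw [← he, ← integral_sub hi4 hi7]
  refine (norm_integral_le_integral_norm _).trans ?_
  rw [← integral_const_mul, ← integral_const_mul, ← integral_add (hi2.const_mul _) (hi3.const_mul _)]
  exact integral_mono (hi4.sub hi7).norm ((hi2.const_mul _).add (hi3.const_mul _))
    fun ω => norm_exp_mul_I_sub_taylor_le hη0 hη (ξ ω)

/-- A quantitative form of the **Lindeberg central limit theorem**. -/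
theorem norm_integral_exp_sum_sub_le {ι : Type*} [Fintype ι] {ξ : ι → Ω → ℝ}
    (hind : iIndepFun ξ μ) (hξ : ∀ i, MemLp (ξ i) 2 μ) (h0 : ∀ i, ∫ ω, ξ i ω ∂μ = 0)
    {η v L : ℝ} (hη0 : 0 ≤ η) (hη : η ≤ 1) (hv : ∑ i, ∫ ω, ξ i ω ^ 2 ∂μ = v)
    (hL : ∑ i, ∫ ω, {y : ℝ | η ^ 2 < y ^ 2}.indicator (fun y => y ^ 2) (ξ i ω) ∂μ ≤ L) :
    ‖∫ ω, Complex.exp ((∑ i, ξ i ω : ℝ) * Complex.I) ∂μ - Complex.exp (-(v : ℂ) / 2)‖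
      ≤ η * v + 4 * L + (η ^ 2 + L) * v := by
  have hm i := (hξ i).aestronglyMeasurable.aemeasurable
  set s : ι → ℝ := fun i => ∫ ω, ξ i ω ^ 2 ∂μ with hs
  set l : ι → ℝ := fun i =>
    ∫ ω, {y : ℝ | η ^ 2 < y ^ 2}.indicator (fun y => y ^ 2) (ξ i ω) ∂μ with hl
  have hs0 i : 0 ≤ s i := integral_nonneg fun ω => sq_nonneg _
  have hl0 i : 0 ≤ l i :=
    integral_nonneg fun ω => Set.indicator_nonneg (fun y _ => sq_nonneg y) _
  have hlL i : l i ≤ L :=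
    (Finset.single_le_sum (fun j _ => hl0 j) (Finset.mem_univ i)).trans hL
  have hmeas : Measurable ({y : ℝ | η ^ 2 < y ^ 2}.indicator (fun y => y ^ 2)) :=
    (measurable_id.pow_const 2).indicator (measurableSet_lt measurable_const (by fun_prop))
  -- No single variance dominates. The second-order errors `(s i / 2) ^ 2` of the Gaussian factors
  -- then add up to at most `(η ^ 2 + L) * v`.
  have hsl i : s i ≤ η ^ 2 + L := by
    have hi2 : Integrable (fun ω => ξ i ω ^ 2) μ := (hξ i).integrable_sq
    have hi3 : Integrable
        (fun ω => {y : ℝ | η ^ 2 < y ^ 2}.indicator (fun y => y ^ 2) (ξ i ω)) μ := by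
      refine hi2.mono' (hmeas.comp_aemeasurable (hm i)).aestronglyMeasurable
        (.of_forall fun ω => ?_)
      rw [Real.norm_of_nonneg (Set.indicator_nonneg (fun y _ => sq_nonneg y) _)]
      exact Set.indicator_le_self' (fun y _ => sq_nonneg y) _
    have : s i ≤ η ^ 2 + l i := by
      calc s i ≤ ∫ ω, (η ^ 2
              + {y : ℝ | η ^ 2 < y ^ 2}.indicator (fun y => y ^ 2) (ξ i ω)) ∂μ := by
            refine integral_mono hi2 ((integrable_const _).add hi3) fun ω => ?_
            by_cases h : η ^ 2 < ξ i ω ^ 2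
            · simp only [Set.indicator, Set.mem_ofPred_eq, h, if_true]
              nlinarith [sq_nonneg η]
            · simp only [Set.indicator, Set.mem_ofPred_eq, h, if_false]
              linarith
        _ = _ := by
            rw [integral_add (integrable_const _) hi3]; simp [l]
    linarith [hlL i]
  have hprod : ∫ ω, Complex.exp ((∑ i, ξ i ω : ℝ) * Complex.I) ∂μ
      = ∏ i, ∫ ω, Complex.exp (ξ i ω * Complex.I) ∂μ := by
    have := hind.integral_fun_prod_comp (f := fun _ x => Complex.exp ((x : ℝ) * Complex.I))
      hm (fun i => by fun_prop)
    rw [← this]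
    congr 1 with ω
    rw [← Complex.exp_sum, ← Finset.sum_mul]
    push_cast
    rfl
  -- The Gaussian characteristic function is split into factors with the same variances `s i`, to be
  -- compared one by one.
  have hexp : Complex.exp (-(v : ℂ) / 2) = ∏ i, Complex.exp ((-(s i / 2) : ℝ)) := by
    rw [← Complex.exp_sum, ← hv]
    congr 1
    push_cast
    rw [Finset.sum_neg_distrib, ← Finset.sum_div]
    ring
  rw [hprod, hexp]
  refine (norm_prod_sub_prod_le _ _ _ ?_ ?_).trans ?_
  · intro i _
    refine (norm_integral_le_integral_norm _).trans ?_
    simp [Complex.norm_exp_ofReal_mul_I]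
  · intro i _
    rw [← Complex.ofReal_exp, Complex.norm_real, Real.norm_of_nonneg (Real.exp_pos _).le,
      Real.exp_le_one_iff]
    linarith [hs0 i]
  have hterm i : ‖∫ ω, Complex.exp (ξ i ω * Complex.I) ∂μ - Complex.exp ((-(s i / 2) : ℝ))‖
      ≤ η * s i + 4 * l i + (η ^ 2 + L) * s i := by
    have h1 := norm_integral_exp_sub_le (hξ i) (h0 i) hη0 hη
    have h2 : ‖(1 - (s i : ℝ) / 2 : ℂ) - Complex.exp ((-(s i / 2) : ℝ))‖ ≤ (s i / 2) ^ 2 := by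
      rw [norm_sub_rev, ← Complex.ofReal_exp]
      have := abs_exp_neg_sub_one_sub_le (u := s i / 2) (by linarith [hs0 i])
      rw [← Real.norm_eq_abs, ← Complex.norm_real] at this
      simpa using this
    refine (norm_sub_le_norm_sub_add_norm_sub _ _ _).trans (add_le_add h1 (h2.trans ?_))
    nlinarith [hs0 i, hsl i]
  refine (Finset.sum_le_sum fun i _ => hterm i).trans ?_
  rw [Finset.sum_add_distrib, Finset.sum_add_distrib, ← Finset.mul_sum, ← Finset.mul_sum,
    ← Finset.mul_sum, hv]
  linarith

end Lindeberg

/-! ### Moments under complete randomization of one stratum -/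

theorem integral_uniformOn_univ {α : Type*} [Fintype α] [MeasurableSpace α]
    [MeasurableSingletonClass α] (f : α → ℝ) :
    ∫ a, f a ∂(uniformOn (Set.univ : Set α)) = (Fintype.card α : ℝ)⁻¹ * ∑ a, f a := by
  rw [uniformOn, ProbabilityTheory.cond, Measure.restrict_univ, integral_smul_measure,
    integral_fintype (.of_finite)]
  simp

namespace StratumAssignment

variable {n m : ℕ}

/-- Relabelling the units of a stratum by a permutation. -/
def permute (σ : Equiv.Perm (Fin n)) : Equiv.Perm (StratumAssignment n m) where
  toFun a := ⟨a.1 ∘ σ, (Finset.card_equiv σ (by simp)).trans a.2⟩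
  invFun a := ⟨a.1 ∘ σ.symm, (Finset.card_equiv σ.symm (by simp)).trans a.2⟩
  left_inv a := by ext; simp
  right_inv a := by ext; simp

@[simp]
theorem permute_apply (σ : Equiv.Perm (Fin n)) (a : StratumAssignment n m) (i : Fin n) :
    (permute σ a).1 i = a.1 (σ i) := rfl

/-- The law of complete randomization. -/
noncomputable abbrev law (n m : ℕ) : Measure (StratumAssignment n m) := uniformOn Set.univ

theorem integral_permute (σ : Equiv.Perm (Fin n)) (f : StratumAssignment n m → ℝ) :
    ∫ a, f (permute σ a) ∂law n m = ∫ a, f a ∂law n m := by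
  rw [integral_uniformOn_univ, integral_uniformOn_univ, Equiv.sum_comp (permute σ) f]

/-- The centered treatment indicator of a unit. -/
noncomputable def dev (i : Fin n) (a : StratumAssignment n m) : ℝ :=
  (if a.1 i = 1 then 1 else 0) - (m : ℝ) / n

theorem sum_dev (h : 0 < n) (a : StratumAssignment n m) : ∑ i, dev i a = 0 := by
  have hn : (n : ℝ) ≠ 0 := by positivity
  simp only [dev, Finset.sum_sub_distrib, Finset.sum_boole, a.2]
  simp
  field_simp
  simp

theorem dev_sq (i : Fin n) (a : StratumAssignment n m) :
    dev i a * dev i a = (1 - 2 * ((m : ℝ) / n)) * dev i a + m / n * (1 - m / n) := by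
  unfold dev
  split_ifs <;> ring

/-- Units are exchangeable, so all these means agree; they sum to zero because the number of treated
units is fixed. -/
theorem integral_dev (i : Fin n) : ∫ a, dev i a ∂law n m = 0 := by
  have hn : 0 < n := i.pos
  have hc : ∀ j, ∫ a, dev j a ∂law n m = ∫ a, dev i a ∂law n m := fun j => by
    rw [← integral_permute (Equiv.swap i j)]
    simp [dev]
  have hs : ∑ j, ∫ a, dev j a ∂law n m = 0 := by
    rw [← integral_finsetSum _ fun j _ => .of_finite]
    simp [sum_dev hn]
  simp only [hc, Finset.sum_const, Finset.card_univ, Fintype.card_fin, nsmul_eq_mul,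
    mul_eq_zero, Nat.cast_eq_zero] at hs
  exact hs.resolve_left hn.ne'

theorem integral_dev_mul_self (h : m ≤ n) (i : Fin n) :
    ∫ a, dev i a * dev i a ∂law n m = m / n * (1 - m / n) := by
  have := StratumAssignment.nonempty h
  simp only [dev_sq]
  rw [integral_add (.of_finite) (.of_finite), integral_const_mul,
    integral_dev]
  simp

/-- A swap fixing `i` shows that all off-diagonal covariances with `i` agree. As the deviations sum
to zero, so does each row of the covariance matrix, and the diagonal entry determines the rest. -/
theorem integral_dev_mul_dev (h : m ≤ n) (hn : 2 ≤ n) (i j : Fin n) :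
    ∫ a, dev i a * dev j a ∂law n m
      = m / n * (1 - m / n) / (n - 1) * ((if j = i then (n : ℝ) else 0) - 1) := by
  have hn1 : (0 : ℝ) < n - 1 := by
    have : (2 : ℝ) ≤ n := by exact_mod_cast hn
    linarith
  by_cases hij : j = i
  · subst hij
    rw [integral_dev_mul_self h]
    simp
    field_simp
  have hs : ∑ k, ∫ a, dev i a * dev k a ∂law n m = 0 := by
    rw [← integral_finsetSum _ fun j _ => .of_finite]
    simp [← Finset.mul_sum, sum_dev (by omega : 0 < n)]
  have hc : ∀ k ∈ Finset.univ.erase i,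
      ∫ a, dev i a * dev k a ∂law n m = ∫ a, dev i a * dev j a ∂law n m := fun k hk => by
    rw [← integral_permute (Equiv.swap j k)]
    have hki : k ≠ i := Finset.ne_of_mem_erase hk
    simp [dev, Equiv.swap_apply_of_ne_of_ne (Ne.symm hij) hki.symm]
  rw [← Finset.add_sum_erase _ _ (Finset.mem_univ i), Finset.sum_congr rfl hc,
    integral_dev_mul_self h, Finset.sum_const, Finset.card_erase_of_mem (Finset.mem_univ i),
    Finset.card_univ, Fintype.card_fin, nsmul_eq_mul, Nat.cast_sub (by omega)] at hs
  simp only [hij, if_false]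
  push_cast at hs
  field_simp
  field_simp at hs
  linarith

/-- The centered linear statistic with scores `u`. -/
noncomputable def linStat (u : Fin n → ℝ) (a : StratumAssignment n m) : ℝ := ∑ i, dev i a * u i

theorem integral_linStat (u : Fin n → ℝ) : ∫ a, linStat u a ∂law n m = 0 := by
  unfold linStat
  rw [integral_finsetSum _ fun j _ => .of_finite]
  simp [integral_mul_const, integral_dev]

theorem integral_linStat_sq (h : m ≤ n) (hn : 2 ≤ n) (u : Fin n → ℝ) :
    ∫ a, linStat u a ^ 2 ∂law n m
      = m / n * (1 - m / n) / (n - 1) * (n * ∑ i, u i ^ 2 - (∑ i, u i) ^ 2) := by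
  have : ∀ a : StratumAssignment n m,
      linStat u a ^ 2 = ∑ i, ∑ j, dev i a * dev j a * (u i * u j) := fun a => by
    rw [linStat, sq, Finset.sum_mul_sum]
    exact Finset.sum_congr rfl fun i _ => Finset.sum_congr rfl fun j _ => by ring
  simp only [this]
  rw [integral_finsetSum _ fun j _ => .of_finite]
  simp_rw [integral_finsetSum Finset.univ fun j _ => .of_finite, integral_mul_const,
    integral_dev_mul_dev h hn, mul_assoc, ← Finset.mul_sum, sub_mul, one_mul,
    Finset.sum_sub_distrib, ite_mul, zero_mul]
  simp only [Finset.sum_ite_eq', Finset.mem_univ, if_true]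
  rw [sq (∑ i, u i), Finset.sum_mul_sum, Finset.mul_sum]
  simp only [sq]

end StratumAssignment

/-! ### Exact linearization of the Hájek estimators and its variance -/

namespace StratifiedExperiment

open StratumAssignment

variable (E : StratifiedExperiment)

/-- The sum over the strata of the centered linear statistics with scores `u`. -/
noncomputable def linSum (u : (b : Fin E.numStrata) → Fin (E.size b) → ℝ) (ω : E.Assignment) : ℝ :=
  ∑ b, linStat (u b) (ω b)

theorem two_le_size (b : Fin E.numStrata) : 2 ≤ E.size b := by
  have := E.treated_pos b
  have := E.treated_lt b
  omega

theorem memLp_two_linStat (u : (b : Fin E.numStrata) → Fin (E.size b) → ℝ) (b : Fin E.numStrata) :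
    MemLp (fun ω : E.Assignment => linStat (u b) (ω b)) 2 E.P := .of_discrete

theorem iIndepFun_linStat (u : (b : Fin E.numStrata) → Fin (E.size b) → ℝ) :
    iIndepFun (fun b (ω : E.Assignment) => linStat (u b) (ω b)) E.P :=
  iIndepFun_pi fun _ => (Measurable.of_discrete).aemeasurable

theorem integral_comp_stratum (b : Fin E.numStrata)
    (f : StratumAssignment (E.size b) (E.treated b) → ℝ) :
    ∫ ω, f (ω b) ∂E.P = ∫ a, f a ∂law (E.size b) (E.treated b) :=
  integral_comp_eval (Measurable.of_discrete).aestronglyMeasurable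

theorem integral_linStat_stratum (u : (b : Fin E.numStrata) → Fin (E.size b) → ℝ)
    (b : Fin E.numStrata) : ∫ ω, linStat (u b) (ω b) ∂E.P = 0 := by
  rw [E.integral_comp_stratum b (linStat (u b)), integral_linStat]

theorem prob_one (b : Fin E.numStrata) : E.prob b 1 = (E.treated b : ℝ) / E.size b := by
  simp [prob, armSize]

theorem prob_zero (b : Fin E.numStrata) : E.prob b 0 = 1 - E.prob b 1 := by
  have h : (E.size b : ℝ) ≠ 0 := by
    have := E.two_le_size b
    positivity
  simp [prob, armSize, Nat.cast_sub (E.treated_lt b).le]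
  field_simp

theorem prob_pos (b : Fin E.numStrata) (z : Fin 2) : 0 < E.prob b z := by
  have h1 := E.treated_pos b
  have h2 := E.treated_lt b
  have h : 0 < E.armSize b z := by
    unfold armSize
    split_ifs <;> omega
  unfold prob
  have : 0 < E.size b := by omega
  positivity

theorem integral_linStat_stratum_sq (u : (b : Fin E.numStrata) → Fin (E.size b) → ℝ)
    (b : Fin E.numStrata) : ∫ ω, linStat (u b) (ω b) ^ 2 ∂E.P
      = E.prob b 1 * E.prob b 0 / (E.size b - 1)
        * (E.size b * ∑ i, u b i ^ 2 - (∑ i, u b i) ^ 2) := by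
  rw [E.integral_comp_stratum b (fun a => linStat (u b) a ^ 2),
    integral_linStat_sq (E.treated_lt b).le (E.two_le_size b), prob_zero, prob_one]

theorem integral_linSum_sq (u : (b : Fin E.numStrata) → Fin (E.size b) → ℝ) :
    ∫ ω, E.linSum u ω ^ 2 ∂E.P = ∑ b, ∫ ω, linStat (u b) (ω b) ^ 2 ∂E.P := by
  have h := variance_sum_pi (μ := fun b => law (E.size b) (E.treated b))
    (X := fun b => linStat (u b)) (fun b => .of_discrete)
  have h0 : ∫ ω, E.linSum u ω ∂E.P = 0 := by
    unfold linSum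
    rw [integral_finsetSum _ fun b _ => .of_finite]
    simp [integral_linStat_stratum]
  have e : (∑ b, fun ω : E.Assignment => linStat (u b) (ω b)) = E.linSum u := by
    ext ω; simp [linSum]
  rw [e] at h
  have hl := variance_of_integral_eq_zero (X := E.linSum u) (μ := E.P)
    (Measurable.of_discrete).aemeasurable h0
  change Var[E.linSum u; E.P] = _ at h
  rw [← hl, h]
  refine Finset.sum_congr rfl fun b _ => ?_
  rw [variance_of_integral_eq_zero (Measurable.of_discrete).aemeasurable (integral_linStat _),
    ← E.integral_comp_stratum b (fun a => linStat (u b) a ^ 2)]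

theorem ipw_one (b : Fin E.numStrata) (i : Fin (E.size b)) (ω : E.Assignment) :
    E.ipw 1 b i ω = 1 + dev i (ω b) / E.prob b 1 := by
  have h := (E.prob_pos b 1).ne'
  simp only [ipw, dev, ← prob_one]
  split_ifs <;> field_simp <;> ring

theorem ipw_zero (b : Fin E.numStrata) (i : Fin (E.size b)) (ω : E.Assignment) :
    E.ipw 0 b i ω = 1 - dev i (ω b) / E.prob b 0 := by
  have h := (E.prob_pos b 0).ne'
  have h1 : (E.treated b : ℝ) / E.size b = 1 - E.prob b 0 := by rw [prob_zero, prob_one]; ring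
  simp only [ipw, dev, h1]
  have : (ω b).1 i = 0 ↔ ¬ (ω b).1 i = 1 := by omega
  simp only [this]
  split_ifs <;> field_simp <;> ring

/-- The signed inverse probability `1 / π_{b1}` for treatment, `-1 / π_{b0}` for control. -/
noncomputable def signedInv (z : Fin 2) (b : Fin E.numStrata) : ℝ :=
  if z = 1 then (E.prob b 1)⁻¹ else -(E.prob b 0)⁻¹

/-- Both arms are driven by the same deviation with opposite signs, whence the minus sign in
`sigma01`. -/
theorem ipw_eq (z : Fin 2) (b : Fin E.numStrata) (i : Fin (E.size b)) (ω : E.Assignment) :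
    E.ipw z b i ω = 1 + dev i (ω b) * E.signedInv z b := by
  fin_cases z
  · simp [ipw_zero, signedInv]; ring
  · simp [ipw_one, signedInv]; ring

theorem sum_ipw_mul (z : Fin 2) (g : (b : Fin E.numStrata) → Fin (E.size b) → ℝ)
    (ω : E.Assignment) : ∑ b, ∑ i, E.ipw z b i ω * g b i
      = ∑ b, ∑ i, g b i + E.linSum (fun b i => E.signedInv z b * g b i) ω := by
  simp only [linSum, linStat, ipw_eq, ← Finset.sum_add_distrib]
  exact Finset.sum_congr rfl fun b _ => Finset.sum_congr rfl fun i _ => by ring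

/-- The scores of the relative fluctuation of the estimated total weight of arm `z`. -/
noncomputable def weightScore (z : Fin 2) (b : Fin E.numStrata) (i : Fin (E.size b)) : ℝ :=
  E.signedInv z b * (E.w b i / E.W)

/-- The scores of the linearized estimator of `√W ρ_z`. -/
noncomputable def armScore (z : Fin 2) (b : Fin E.numStrata) (i : Fin (E.size b)) : ℝ :=
  E.signedInv z b * ((√E.W)⁻¹ * (E.w b i * (E.y b i z - E.ρ z)))

/-- The scores of the linear combination with coefficients `p`, `q` of the linearized estimators of
`√W ρ₁` and `√W ρ₀`. -/
noncomputable def combScore (p q : ℝ) (b : Fin E.numStrata) (i : Fin (E.size b)) : ℝ :=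
  p * E.armScore 1 b i + q * E.armScore 0 b i

theorem linSum_combScore (p q : ℝ) (ω : E.Assignment) :
    E.linSum (E.combScore p q) ω = p * E.linSum (E.armScore 1) ω + q * E.linSum (E.armScore 0) ω := by
  simp only [linSum, linStat, combScore, Finset.mul_sum, ← Finset.sum_add_distrib]
  exact Finset.sum_congr rfl fun b _ => Finset.sum_congr rfl fun i _ => by ring

theorem W_pos (h : 0 < E.numStrata) : 0 < E.W := by
  have : Nonempty (Fin E.numStrata) := ⟨⟨0, h⟩⟩
  refine Finset.sum_pos (fun b _ => ?_) Finset.univ_nonempty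
  have : Nonempty (Fin (E.size b)) := ⟨⟨0, by have := E.two_le_size b; omega⟩⟩
  exact Finset.sum_pos (fun i _ => E.w_pos b i) Finset.univ_nonempty

variable {E}

theorem sqrt_W_mul_ρHat_sub (hW : 0 < E.W) (z : Fin 2) (ω : E.Assignment)
    (h : 1 + E.linSum (E.weightScore z) ω ≠ 0) :
    √E.W * (E.ρHat z ω - E.ρ z)
      = E.linSum (E.armScore z) ω / (1 + E.linSum (E.weightScore z) ω) := by
  have hden : ∑ b, ∑ i, E.ipw z b i ω * E.w b i = E.W * (1 + E.linSum (E.weightScore z) ω) := by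
    have h1 := E.sum_ipw_mul z (fun b i => E.w b i / E.W) ω
    change _ = _ + E.linSum (E.weightScore z) ω at h1
    simp only [← mul_div_assoc, ← Finset.sum_div] at h1
    rw [show ∑ b, ∑ i, E.w b i = E.W from rfl, div_self hW.ne', div_eq_iff hW.ne'] at h1
    rw [h1, mul_comm]
  have hcent : ∑ b, ∑ i, E.w b i * (E.y b i z - E.ρ z) = 0 := by
    simp only [mul_sub, Finset.sum_sub_distrib, ← Finset.sum_mul]
    rw [show ∑ b, ∑ i, E.w b i = E.W from rfl, ρ, mul_div_cancel₀ _ hW.ne', sub_self]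
  have hs : √E.W ≠ 0 := (Real.sqrt_pos.2 hW).ne'
  have hnum : ∑ b, ∑ i, E.ipw z b i ω * E.w b i * (E.y b i z - E.ρ z)
      = √E.W * E.linSum (E.armScore z) ω := by
    have h1 := E.sum_ipw_mul z (fun b i => (√E.W)⁻¹ * (E.w b i * (E.y b i z - E.ρ z))) ω
    change _ = _ + E.linSum (E.armScore z) ω at h1
    simp only [mul_left_comm _ (√E.W)⁻¹, ← Finset.mul_sum, hcent, mul_zero, zero_add] at h1
    rw [inv_mul_eq_iff_eq_mul₀ hs] at h1
    simp only [mul_assoc, h1]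
  have hdiff : E.ρHat z ω - E.ρ z = (∑ b, ∑ i, E.ipw z b i ω * E.w b i * (E.y b i z - E.ρ z))
      / ∑ b, ∑ i, E.ipw z b i ω * E.w b i := by
    have hd : ∑ b, ∑ i, E.ipw z b i ω * E.w b i ≠ 0 := by
      rw [hden]; exact mul_ne_zero hW.ne' h
    rw [ρHat, eq_div_iff hd, sub_mul, div_mul_cancel₀ _ hd]
    simp only [mul_sub, Finset.sum_sub_distrib, ← Finset.sum_mul]
    ring
  rw [hdiff, hnum, hden]
  field_simp
  rw [Real.sq_sqrt hW.le, mul_comm]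

/-- The quadratic form of `Σ_n` in the coordinates `(ρ₁, ρ₀)`. -/
noncomputable def quad (E : StratifiedExperiment) (p q : ℝ) : ℝ :=
  p ^ 2 * E.sigmaSq 1 + 2 * p * q * E.sigma01 + q ^ 2 * E.sigmaSq 0

theorem S_eq (b : Fin E.numStrata) (z z' : Fin 2) :
    E.S b z z' = (∑ i, E.γ z b i * E.γ z' b i - (∑ i, E.γ z b i) * (∑ i, E.γ z' b i) / E.size b)
      / (E.size b - 1) := by
  have h : (E.size b : ℝ) ≠ 0 := by
    have := E.two_le_size b
    positivity
  rw [S]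
  congr 1
  simp only [sub_mul, mul_sub, Finset.sum_sub_distrib, ← Finset.sum_mul, ← Finset.mul_sum,
    Finset.sum_const, Finset.card_univ, Fintype.card_fin, nsmul_eq_mul, γMean]
  field_simp
  ring

/-- The scores are proportional to `p γ₁ / π₁ - q γ₀ / π₀`, and the randomization variance carries a
factor `π₁ π₀`. It turns `1 / π_z²` into `(1 - π_z) / π_z = n_b (1 / n_{bz} - 1 / n_b)` and the
cross factor `1 / (π₁ π₀)` into `1`. -/
theorem integral_linStat_combScore_sq (hW : 0 < E.W) (p q : ℝ) (b : Fin E.numStrata) :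
    ∫ ω, linStat (E.combScore p q b) (ω b) ^ 2 ∂E.P
      = (p ^ 2 * (((E.armSize b 1 : ℝ)⁻¹ - (E.size b : ℝ)⁻¹) * E.S b 1 1)
        - 2 * p * q * (E.S b 0 1 / E.size b)
        + q ^ 2 * (((E.armSize b 0 : ℝ)⁻¹ - (E.size b : ℝ)⁻¹) * E.S b 0 0)) / E.W := by
  have hn : (E.size b : ℝ) ≠ 0 := by
    have := E.two_le_size b
    positivity
  have hn1 : (E.size b : ℝ) - 1 ≠ 0 := by
    have : (2 : ℝ) ≤ E.size b := by exact_mod_cast E.two_le_size b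
    intro h; linarith
  have h1 := (E.prob_pos b 1).ne'
  have h0 := (E.prob_pos b 0).ne'
  have ha z : (E.armSize b z : ℝ) = E.prob b z * E.size b := by
    rw [prob, div_mul_cancel₀ _ hn]
  have hsc i : E.combScore p q b i = (√E.W)⁻¹ * (E.size b : ℝ)⁻¹
      * (p / E.prob b 1 * E.γ 1 b i - q / E.prob b 0 * E.γ 0 b i) := by
    simp [combScore, armScore, signedInv, γ]
    field_simp
    ring
  have hcross : ∑ i, E.γ 0 b i * E.γ 1 b i = ∑ i, E.γ 1 b i * E.γ 0 b i :=
    Finset.sum_congr rfl fun i _ => mul_comm _ _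
  have hsq : ∑ i, (p / E.prob b 1 * E.γ 1 b i - q / E.prob b 0 * E.γ 0 b i) ^ 2
      = (p / E.prob b 1) ^ 2 * ∑ i, E.γ 1 b i * E.γ 1 b i
        - 2 * (p / E.prob b 1) * (q / E.prob b 0) * ∑ i, E.γ 1 b i * E.γ 0 b i
        + (q / E.prob b 0) ^ 2 * ∑ i, E.γ 0 b i * E.γ 0 b i := by
    simp only [Finset.mul_sum, ← Finset.sum_sub_distrib, ← Finset.sum_add_distrib]
    exact Finset.sum_congr rfl fun i _ => by ring
  rw [integral_linStat_stratum_sq]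
  simp only [hsc, mul_pow, ← Finset.mul_sum, inv_pow, Real.sq_sqrt hW.le, Finset.sum_sub_distrib,
    hsq, S_eq, ha, hcross]
  generalize ∑ i, E.γ 1 b i * E.γ 1 b i = A
  generalize ∑ i, E.γ 1 b i * E.γ 0 b i = B
  generalize ∑ i, E.γ 0 b i * E.γ 0 b i = C
  generalize ∑ i, E.γ 1 b i = F
  generalize ∑ i, E.γ 0 b i = G
  have hp := E.prob_zero b
  rw [hp] at h0 ⊢
  generalize E.prob b 1 = π at *
  field_simp
  ring

theorem sum_integral_linStat_combScore_sq (hW : 0 < E.W) (p q : ℝ) :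
    ∑ b, ∫ ω, linStat (E.combScore p q b) (ω b) ^ 2 ∂E.P = E.quad p q := by
  simp only [integral_linStat_combScore_sq hW, quad, sigmaSq, sigma01, ← Finset.sum_div,
    Finset.sum_add_distrib, Finset.sum_sub_distrib, ← Finset.mul_sum]
  ring

theorem integral_linSum_armScore_sq (hW : 0 < E.W) (z : Fin 2) :
    ∫ ω, E.linSum (E.armScore z) ω ^ 2 ∂E.P = E.sigmaSq z := by
  have h1 := sum_integral_linStat_combScore_sq hW 1 0
  have h0 := sum_integral_linStat_combScore_sq hW 0 1
  rw [← integral_linSum_sq] at h1 h0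
  fin_cases z
  · simpa [linSum_combScore, quad] using h0
  · simpa [linSum_combScore, quad] using h1

theorem sigmaSq_nonneg (hW : 0 < E.W) (z : Fin 2) : 0 ≤ E.sigmaSq z := by
  rw [← integral_linSum_armScore_sq hW]
  exact integral_nonneg fun ω => sq_nonneg _

/-- The squared-sum term of the variance is dropped; the `2` bounds `n_b / (n_b - 1)` and `1 / c²`
bounds the squared inverse probability. -/
theorem integral_linSum_weightScore_sq_le (hW : 0 < E.W) {c : ℝ} (hc : 0 < c)
    (h : ∀ b z, c ≤ E.prob b z) (z : Fin 2) :
    ∫ ω, E.linSum (E.weightScore z) ω ^ 2 ∂E.P ≤ 2 / c ^ 2 * (E.kishESS)⁻¹ := by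
  rw [integral_linSum_sq, kishESS, inv_div, ← mul_div_assoc, Finset.mul_sum, Finset.sum_div]
  refine Finset.sum_le_sum fun b _ => ?_
  have hn : (2 : ℝ) ≤ E.size b := by exact_mod_cast E.two_le_size b
  have hsi : E.signedInv z b ^ 2 ≤ (c ^ 2)⁻¹ := by
    have : E.signedInv z b ^ 2 = (E.prob b z ^ 2)⁻¹ := by
      fin_cases z <;> simp [signedInv]
    rw [this]
    exact inv_anti₀ (by positivity) (pow_le_pow_left₀ hc.le (h b z) 2)
  have hp0 := E.prob_zero b
  have hp1 := E.prob_pos b 1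
  have hp2 := E.prob_pos b 0
  have hpp : E.prob b 1 * E.prob b 0 ≤ 1 := by nlinarith
  have hw : (0 : ℝ) ≤ ∑ i, E.w b i ^ 2 := Finset.sum_nonneg fun i _ => sq_nonneg _
  rw [integral_linStat_stratum_sq]
  simp only [weightScore, mul_pow, div_pow, ← Finset.mul_sum, ← Finset.sum_div]
  calc _ ≤ E.prob b 1 * E.prob b 0 / (E.size b - 1)
        * (E.size b * (E.signedInv z b ^ 2 * ((∑ i, E.w b i ^ 2) / E.W ^ 2))) := by
        gcongr
        · exact div_nonneg (by positivity) (by linarith)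
        · exact sub_le_self _ (by positivity)
    _ = (E.prob b 1 * E.prob b 0) * (E.size b / (E.size b - 1)) * E.signedInv z b ^ 2
        * ((∑ i, E.w b i ^ 2) / E.W ^ 2) := by ring
    _ ≤ 1 * 2 * (c ^ 2)⁻¹ * ((∑ i, E.w b i ^ 2) / E.W ^ 2) := by
        have : (E.size b : ℝ) / (E.size b - 1) ≤ 2 := by
          rw [div_le_iff₀ (by linarith)]; linarith
        gcongr
        exact div_nonneg (by positivity) (by linarith)
    _ = _ := by ring

end StratifiedExperiment

/-! ### Spectral facts on real symmetric matrices -/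

namespace Matrix.IsHermitian

variable {n : Type*} [Fintype n] [DecidableEq n] {A : Matrix n n ℝ} (hA : A.IsHermitian)

theorem iInf_eigenvalues_mul_dotProduct_self_le (x : n → ℝ) :
    (⨅ j, hA.eigenvalues j) * (x ⬝ᵥ x) ≤ x ⬝ᵥ A *ᵥ x := by
  set U : Matrix n n ℝ := hA.eigenvectorUnitary.1
  have hUU : U * star U = 1 := Unitary.coe_mul_star_self hA.eigenvectorUnitary
  have hA' : A = U * diagonal hA.eigenvalues * star U := by
    conv_lhs => rw [hA.spectral_theorem, Unitary.conjStarAlgAut_apply]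
    rfl
  have hst : star U = Uᵀ := by rw [star_eq_conjTranspose, conjTranspose_eq_transpose_of_trivial]
  set y := star U *ᵥ x with hy
  have h1 : x ⬝ᵥ A *ᵥ x = y ⬝ᵥ diagonal hA.eigenvalues *ᵥ y := by
    conv_lhs => rw [hA']
    rw [← mulVec_mulVec, ← mulVec_mulVec, dotProduct_mulVec, ← mulVec_transpose, ← hst]
  have h2 : x ⬝ᵥ x = y ⬝ᵥ y := by
    rw [hy, dotProduct_mulVec, ← mulVec_transpose, mulVec_mulVec, hst, transpose_transpose, ← hst,
      hUU, one_mulVec]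
  rw [h1, h2]
  simp only [dotProduct, mulVec_diagonal, Finset.mul_sum]
  refine Finset.sum_le_sum fun j _ => ?_
  have := ciInf_le (Set.finite_range hA.eigenvalues).bddBelow j
  nlinarith [mul_self_nonneg (y j)]

theorem isHermitian_cfc (f : ℝ → ℝ) : (hA.cfc f).IsHermitian := by
  rw [← hA.cfc_eq]
  exact cfc_predicate f A

theorem cfc_inv_sqrt_mul_mul (h : ∀ j, 0 < hA.eigenvalues j) :
    hA.cfc (fun x => (√x)⁻¹) * A * hA.cfc (fun x => (√x)⁻¹) = 1 := by
  set U : Matrix n n ℝ := hA.eigenvectorUnitary.1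
  have hUU : U * star U = 1 := Unitary.coe_mul_star_self hA.eigenvectorUnitary
  have hUU' : star U * U = 1 := Unitary.coe_star_mul_self hA.eigenvectorUnitary
  have hA' : A = U * diagonal hA.eigenvalues * star U := by
    conv_lhs => rw [hA.spectral_theorem, Unitary.conjStarAlgAut_apply]
    rfl
  have hS : hA.cfc (fun x => (√x)⁻¹)
      = U * diagonal (fun j => (√(hA.eigenvalues j))⁻¹) * star U := by
    rw [IsHermitian.cfc, Unitary.conjStarAlgAut_apply]
    rfl
  calc _ = U * diagonal (fun j => (√(hA.eigenvalues j))⁻¹) * (star U * U)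
        * diagonal hA.eigenvalues * (star U * U)
        * diagonal (fun j => (√(hA.eigenvalues j))⁻¹) * star U := by
        rw [hS]
        conv_lhs => enter [1, 2]; rw [hA']
        simp only [Matrix.mul_assoc]
    _ = 1 := by
        rw [hUU', Matrix.mul_one, Matrix.mul_one, Matrix.mul_assoc U, diagonal_mul_diagonal,
          Matrix.mul_assoc U, diagonal_mul_diagonal]
        have : (fun i => (√(hA.eigenvalues i))⁻¹ * hA.eigenvalues i * (√(hA.eigenvalues i))⁻¹)
            = fun _ => (1 : ℝ) := by
          ext i
          have hp := Real.sqrt_pos.2 (h i)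
          have hs := Real.mul_self_sqrt (h i).le
          field_simp
          rw [sq, hs]
        rw [this, diagonal_one, Matrix.mul_one, hUU]

end Matrix.IsHermitian

/-! ### Error bound for one population -/

namespace StratifiedExperiment

open StratumAssignment Matrix

variable {E : StratifiedExperiment}

theorem quad_eq_dotProduct (p q : ℝ) : E.quad p q = ![p, q] ⬝ᵥ E.Sigma *ᵥ ![p, q] := by
  simp [quad, Sigma, dotProduct, mulVec, Fin.sum_univ_two]
  ring

theorem lambdaMin_mul_le_quad (p q : ℝ) : E.lambdaMin * (p ^ 2 + q ^ 2) ≤ E.quad p q := by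
  have := E.Sigma_isHermitian.iInf_eigenvalues_mul_dotProduct_self_le ![p, q]
  rw [← quad_eq_dotProduct] at this
  simpa [lambdaMin, dotProduct, Fin.sum_univ_two, sq] using this

/-- By `Σ^{-1/2} Σ Σ^{-1/2} = 1`, the linearized projection on `t` has a variance that does not
depend on the population. -/
theorem quad_SigmaInvSqrt_mulVec (h : 0 < E.lambdaMin) (t : Fin 2 → ℝ) :
    E.quad ((E.SigmaInvSqrt *ᵥ t) 0) ((E.SigmaInvSqrt *ᵥ t) 1) = t ⬝ᵥ t := by
  have hpos : ∀ j, 0 < E.Sigma_isHermitian.eigenvalues j := fun j =>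
    h.trans_le (ciInf_le (Set.finite_range _).bddBelow j)
  have hv : ![(E.SigmaInvSqrt *ᵥ t) 0, (E.SigmaInvSqrt *ᵥ t) 1] = E.SigmaInvSqrt *ᵥ t := by
    ext i; fin_cases i <;> rfl
  have hsymm : E.SigmaInvSqrtᵀ = E.SigmaInvSqrt := by
    have := E.Sigma_isHermitian.isHermitian_cfc (fun x => (√x)⁻¹)
    rwa [IsHermitian, conjTranspose_eq_transpose_of_trivial] at this
  rw [quad_eq_dotProduct, hv]
  nth_rewrite 1 [← hsymm]
  rw [mulVec_transpose, ← dotProduct_mulVec, mulVec_mulVec, mulVec_mulVec,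
    SigmaInvSqrt, E.Sigma_isHermitian.cfc_inv_sqrt_mul_mul hpos, one_mulVec]

theorem inner_standardizedθ (ω : E.Assignment) (t : EuclideanSpace ℝ (Fin 2)) :
    inner ℝ (E.standardizedθ ω) t = (E.SigmaInvSqrt *ᵥ t.ofLp) 0 * (√E.W * (E.ρHat 1 ω - E.ρ 1))
      + (E.SigmaInvSqrt *ᵥ t.ofLp) 1 * (√E.W * (E.ρHat 0 ω - E.ρ 0)) := by
  have hsymm : E.SigmaInvSqrtᵀ = E.SigmaInvSqrt := by
    have := E.Sigma_isHermitian.isHermitian_cfc (fun x => (√x)⁻¹)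
    rwa [IsHermitian, conjTranspose_eq_transpose_of_trivial] at this
  have h10 : E.SigmaInvSqrt 1 0 = E.SigmaInvSqrt 0 1 := congrFun (congrFun hsymm 0) 1
  simp [standardizedθ, PiLp.inner_apply, Fin.sum_univ_two, mulVec, dotProduct, θHat, θ, h10]
  ring

theorem devSq_eq (b : Fin E.numStrata) (ω : E.Assignment) :
    E.devSq b ω = linStat (E.armScore 1 b) (ω b) ^ 2 + linStat (E.armScore 0 b) (ω b) ^ 2 := by
  set e₁ : EuclideanSpace ℝ (Fin 2) := !₂[1, 0]
  set e₀ : EuclideanSpace ℝ (Fin 2) := !₂[0, 1]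
  set K : EuclideanSpace ℝ (Fin 2) := (√E.W)⁻¹ • !₂[∑ i, E.w b i * (E.y b i 1 - E.ρ 1),
    ∑ i, E.w b i * (E.y b i 0 - E.ρ 0)]
  have hsum z (ω : E.Assignment) :
      (√E.W)⁻¹ * ∑ i, E.ipw z b i ω * E.w b i * (E.y b i z - E.ρ z)
        = (√E.W)⁻¹ * ∑ i, E.w b i * (E.y b i z - E.ρ z) + linStat (E.armScore z b) (ω b) := by
    simp only [linStat, armScore, ipw_eq, Finset.mul_sum, ← Finset.sum_add_distrib]
    exact Finset.sum_congr rfl fun i _ => by ring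
  have hX ω : E.X b ω
      = K + (linStat (E.armScore 1 b) (ω b) • e₁ + linStat (E.armScore 0 b) (ω b) • e₀) := by
    ext j
    fin_cases j
    · simp [X, hsum, K, e₁, e₀]
    · simp [X, hsum, K, e₁, e₀]
  have hI : ∫ ω, E.X b ω ∂E.P = K := by
    simp only [hX]
    rw [integral_add .of_finite .of_finite, integral_add .of_finite .of_finite,
      integral_smul_const (fun ω : E.Assignment => linStat (E.armScore 1 b) (ω b)) e₁,
      integral_smul_const (fun ω : E.Assignment => linStat (E.armScore 0 b) (ω b)) e₀,
      integral_linStat_stratum, integral_linStat_stratum]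
    simp
  rw [devSq, hI, hX, add_sub_cancel_left, EuclideanSpace.real_norm_sq_eq, Fin.sum_univ_two]
  simp [e₁, e₀]

theorem linStat_combScore_sq_le (p q : ℝ) (b : Fin E.numStrata) (ω : E.Assignment) :
    linStat (E.combScore p q b) (ω b) ^ 2 ≤ (p ^ 2 + q ^ 2) * E.devSq b ω := by
  have h : linStat (E.combScore p q b) (ω b)
      = p * linStat (E.armScore 1 b) (ω b) + q * linStat (E.armScore 0 b) (ω b) := by
    simp only [linStat, combScore, Finset.mul_sum, ← Finset.sum_add_distrib]
    exact Finset.sum_congr rfl fun i _ => by ring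
  rw [h, devSq_eq]
  nlinarith [sq_nonneg (p * linStat (E.armScore 0 b) (ω b) - q * linStat (E.armScore 1 b) (ω b))]

/-- Cauchy–Schwarz bounds the squared stratum term by `K / λ` times `devSq`. A term above `η ^ 2`
therefore forces `devSq` above `(η ^ 2 / K) * λ`, which is the truncation in `lindeberg`. -/
theorem sum_truncated_le_lindeberg {p q η K : ℝ} (hK : 0 < K) (hlam : 0 < E.lambdaMin)
    (h : E.lambdaMin * (p ^ 2 + q ^ 2) ≤ K) :
    ∑ b, ∫ ω, {y : ℝ | η ^ 2 < y ^ 2}.indicator (fun y => y ^ 2)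
        (linStat (E.combScore p q b) (ω b)) ∂E.P ≤ K * E.lindeberg (η ^ 2 / K) := by
  rw [lindeberg, mul_div_assoc', mul_div_right_comm, Finset.mul_sum]
  refine Finset.sum_le_sum fun b _ => ?_
  rw [← integral_const_mul]
  refine integral_mono .of_finite .of_finite fun ω => ?_
  have hd : 0 ≤ E.devSq b ω := sq_nonneg _
  have hle : linStat (E.combScore p q b) (ω b) ^ 2 ≤ K / E.lambdaMin * E.devSq b ω := by
    refine (linStat_combScore_sq_le p q b ω).trans (mul_le_mul_of_nonneg_right ?_ hd)
    rw [le_div_iff₀ hlam]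
    linarith
  by_cases hy : η ^ 2 < linStat (E.combScore p q b) (ω b) ^ 2
  · have hdev : η ^ 2 / K * E.lambdaMin < E.devSq b ω := by
      have := hy.trans_le hle
      rw [div_mul_eq_mul_div, lt_div_iff₀ hlam] at this
      rw [div_mul_eq_mul_div, div_lt_iff₀ hK]
      linarith
    simp only [Set.indicator, Set.mem_ofPred_eq, hy, hdev, if_true]
    exact hle
  · rw [Set.indicator_of_notMem (by exact hy)]
    exact mul_nonneg (by positivity) (Set.indicator_nonneg (fun _ _ => sq_nonneg _) _)

theorem norm_exp_mul_I_sub_exp_mul_I_le (x y : ℝ) :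
    ‖Complex.exp (x * Complex.I) - Complex.exp (y * Complex.I)‖ ≤ |x - y| := by
  have h : Complex.exp (x * Complex.I) - Complex.exp (y * Complex.I)
      = Complex.exp (y * Complex.I) * (Complex.exp (Complex.I * (x - y : ℝ)) - 1) := by
    rw [mul_sub, ← Complex.exp_add]
    push_cast
    ring_nf
  rw [h, norm_mul, Complex.norm_exp_ofReal_mul_I, one_mul]
  exact Real.norm_exp_I_mul_ofReal_sub_one_le

/-- If `|e|, |f| ≤ 1/2`, then `|M / (1 + e) - M| ≤ 2 |M e| ≤ η M² + η⁻¹ e²`, and likewise for `N`.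
Otherwise `e² + f² ≥ 1/4`, and the trivial bound `2` is at most `8 (e² + f²)`. -/
theorem norm_exp_ratio_sub_le {η : ℝ} (hη : 0 < η) (x : ℝ) {e M f N : ℝ}
    (hx : 1 + e ≠ 0 → 1 + f ≠ 0 → x = M / (1 + e) + N / (1 + f)) :
    ‖Complex.exp (x * Complex.I) - Complex.exp ((M + N : ℝ) * Complex.I)‖
      ≤ η * (M ^ 2 + N ^ 2) + (η⁻¹ + 8) * (e ^ 2 + f ^ 2) := by
  have hηi : 0 < η⁻¹ := inv_pos.2 hη
  by_cases hef : |e| ≤ 1 / 2 ∧ |f| ≤ 1 / 2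
  · have key : ∀ e M : ℝ, |e| ≤ 1 / 2 → |M / (1 + e) - M| ≤ η * M ^ 2 + η⁻¹ * e ^ 2 := by
      intro e M he
      have h1 : 1 / 2 ≤ 1 + e := by linarith [(abs_le.1 he).1]
      have h2 : M / (1 + e) - M = -(M * e / (1 + e)) := by
        have : 1 + e ≠ 0 := by linarith
        field_simp
        ring
      rw [h2, abs_neg, abs_div, abs_mul, abs_of_pos (by linarith : 0 < 1 + e),
        div_le_iff₀ (by linarith)]
      have h3 : 2 * (|M| * |e|) ≤ η * M ^ 2 + η⁻¹ * e ^ 2 := by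
        rw [← sq_abs M, ← sq_abs e]
        have : η * |M| ^ 2 + η⁻¹ * |e| ^ 2 - 2 * (|M| * |e|) = η⁻¹ * (η * |M| - |e|) ^ 2 := by
          field_simp
          ring
        nlinarith [mul_nonneg hηi.le (sq_nonneg (η * |M| - |e|))]
      nlinarith [mul_nonneg (abs_nonneg M) (abs_nonneg e)]
    have he := hef.1
    have hf := hef.2
    have h1 : (1 : ℝ) + e ≠ 0 := by linarith [(abs_le.1 he).1]
    have h2 : (1 : ℝ) + f ≠ 0 := by linarith [(abs_le.1 hf).1]
    refine (norm_exp_mul_I_sub_exp_mul_I_le _ _).trans ?_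
    rw [hx h1 h2, add_sub_add_comm]
    refine (abs_add_le _ _).trans ?_
    linarith [key e M he, key f N hf, sq_nonneg e, sq_nonneg f]
  · have h1 : 1 / 4 ≤ e ^ 2 + f ^ 2 := by
      rw [not_and_or, not_le, not_le] at hef
      rw [← sq_abs e, ← sq_abs f]
      rcases hef with h | h <;> nlinarith [sq_nonneg |e|, sq_nonneg |f|]
    refine (norm_sub_le _ _).trans ?_
    rw [Complex.norm_exp_ofReal_mul_I, Complex.norm_exp_ofReal_mul_I]
    nlinarith [mul_nonneg hη.le (add_nonneg (sq_nonneg M) (sq_nonneg N)),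
      mul_nonneg hηi.le (add_nonneg (sq_nonneg e) (sq_nonneg f))]

/-- The cross term is absorbed by the arithmetic–geometric mean inequality. The variance of the
combination thus controls the two arms separately, which `λ_n` alone would not do, as it bounds only
`p² + q²`. -/
theorem one_sub_mul_le_quad (hW : 0 < E.W) {κ : ℝ} (hκ : 0 ≤ κ)
    (h : |E.sigma01| ≤ κ * (√(E.sigmaSq 0) * √(E.sigmaSq 1))) (p q : ℝ) :
    (1 - κ) * (p ^ 2 * E.sigmaSq 1 + q ^ 2 * E.sigmaSq 0) ≤ E.quad p q := by
  have h1 := Real.mul_self_sqrt (sigmaSq_nonneg hW 1)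
  have h0 := Real.mul_self_sqrt (sigmaSq_nonneg hW 0)
  have hpq : -(p * q * E.sigma01) ≤ κ * ((|p| * √(E.sigmaSq 1)) * (|q| * √(E.sigmaSq 0))) := by
    refine (neg_le_abs _).trans ?_
    rw [abs_mul, abs_mul]
    calc |p| * |q| * |E.sigma01|
        ≤ |p| * |q| * (κ * (√(E.sigmaSq 0) * √(E.sigmaSq 1))) := by gcongr
      _ = _ := by ring
  have ham : 2 * ((|p| * √(E.sigmaSq 1)) * (|q| * √(E.sigmaSq 0)))
      ≤ p ^ 2 * E.sigmaSq 1 + q ^ 2 * E.sigmaSq 0 := by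
    have := two_mul_le_add_sq (|p| * √(E.sigmaSq 1)) (|q| * √(E.sigmaSq 0))
    rw [mul_pow, mul_pow, sq_abs, sq_abs, Real.sq_sqrt (sigmaSq_nonneg hW 1),
      Real.sq_sqrt (sigmaSq_nonneg hW 0)] at this
    linarith
  unfold quad
  nlinarith [mul_le_mul_of_nonneg_left ham hκ]

theorem norm_integral_exp_hajek_sub_le (hB : 0 < E.numStrata) {c κ η v p q : ℝ} (hc : 0 < c)
    (hprob : ∀ b z, c ≤ E.prob b z) (hκ0 : 0 ≤ κ) (hκ1 : κ < 1)
    (hcorr : |E.sigma01| ≤ κ * (√(E.sigmaSq 0) * √(E.sigmaSq 1))) (hlam : 0 < E.lambdaMin)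
    (hη0 : 0 < η) (hη1 : η ≤ 1) (hv : E.quad p q = v) :
    ‖∫ ω, Complex.exp ((p * (√E.W * (E.ρHat 1 ω - E.ρ 1))
        + q * (√E.W * (E.ρHat 0 ω - E.ρ 0)) : ℝ) * Complex.I) ∂E.P - Complex.exp (-(v : ℂ) / 2)‖
      ≤ η * (v / (1 - κ)) + (η⁻¹ + 8) * (4 / c ^ 2 * (E.kishESS)⁻¹)
        + (η * v + 4 * ((v + 1) * E.lindeberg (η ^ 2 / (v + 1)))
          + (η ^ 2 + (v + 1) * E.lindeberg (η ^ 2 / (v + 1))) * v) := by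
  have hW := E.W_pos hB
  have hq := lambdaMin_mul_le_quad (E := E) p q
  have hv0 : 0 ≤ v := by
    rw [← hv]
    exact le_trans (by positivity) hq
  have hclt := norm_integral_exp_sum_sub_le (E.iIndepFun_linStat (E.combScore p q))
    (E.memLp_two_linStat _) (E.integral_linStat_stratum _) hη0.le hη1
    ((sum_integral_linStat_combScore_sq hW p q).trans hv)
    -- `v + 1` instead of `v`, since `v` may vanish and the truncation level is divided by `K`.
    (sum_truncated_le_lindeberg (η := η) (K := v + 1) (by linarith) hlam (by linarith))
  refine (norm_sub_le_norm_sub_add_norm_sub _ _ _).trans (add_le_add ?_ hclt)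
  rw [← integral_sub .of_finite .of_finite]
  refine (norm_integral_le_integral_norm _).trans ?_
  have hpt (ω : E.Assignment) := norm_exp_ratio_sub_le hη0
    (p * (√E.W * (E.ρHat 1 ω - E.ρ 1)) + q * (√E.W * (E.ρHat 0 ω - E.ρ 0)))
    (e := E.linSum (E.weightScore 1) ω) (f := E.linSum (E.weightScore 0) ω)
    (M := p * E.linSum (E.armScore 1) ω) (N := q * E.linSum (E.armScore 0) ω)
    (fun h1 h0 => by
      rw [sqrt_W_mul_ρHat_sub hW 1 ω h1, sqrt_W_mul_ρHat_sub hW 0 ω h0, mul_div_assoc,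
        mul_div_assoc])
  have hsum (ω : E.Assignment) : ∑ b, linStat (E.combScore p q b) (ω b)
      = p * E.linSum (E.armScore 1) ω + q * E.linSum (E.armScore 0) ω := E.linSum_combScore p q ω
  simp only [hsum]
  refine (integral_mono .of_finite .of_finite hpt).trans ?_
  rw [integral_add .of_finite .of_finite, integral_const_mul, integral_const_mul,
    integral_add .of_finite .of_finite, integral_add .of_finite .of_finite]
  simp only [mul_pow]
  rw [integral_const_mul, integral_const_mul, integral_linSum_armScore_sq hW,
    integral_linSum_armScore_sq hW]
  have h1 := integral_linSum_weightScore_sq_le hW hc hprob 1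
  have h0 := integral_linSum_weightScore_sq_le hW hc hprob 0
  have hκ' : 0 < 1 - κ := by linarith
  have hM : p ^ 2 * E.sigmaSq 1 + q ^ 2 * E.sigmaSq 0 ≤ v / (1 - κ) := by
    rw [le_div_iff₀ hκ', ← hv]
    linarith [one_sub_mul_le_quad hW hκ0 hcorr p q]
  have hηi : 0 < η⁻¹ := inv_pos.2 hη0
  refine add_le_add (mul_le_mul_of_nonneg_left hM hη0.le)
    (mul_le_mul_of_nonneg_left ((add_le_add h1 h0).trans (le_of_eq ?_)) (by linarith))
  ring

end StratifiedExperiment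

/-! ### Passage to the limit -/

namespace StratifiedExperiment

open Matrix

/-- Linear combinations of the Hájek estimators whose linearization has asymptotic variance `v` are
asymptotically normal, in terms of characteristic functions. -/
theorem tendsto_integral_exp_hajek (E : ℕ → StratifiedExperiment)
    (hB : Tendsto (fun n => (E n).numStrata) atTop atTop)
    (hoverlap : ∃ c : ℝ, 0 < c ∧ ∀ᶠ n in atTop, ∀ (b : Fin (E n).numStrata) (z : Fin 2),
      (E n).prob b z ∈ Set.Ioo c (1 - c))
    (hKish : Tendsto (fun n => (E n).kishESS) atTop atTop)
    (hnondeg : ∃ κ : ℝ, κ < 1 ∧ ∀ᶠ n in atTop, 0 < (E n).lambdaMin ∧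
      |(E n).sigma01| ≤ κ * (√((E n).sigmaSq 0) * √((E n).sigmaSq 1)))
    (hlindeberg : ∀ ε : ℝ, 0 < ε → Tendsto (fun n => (E n).lindeberg ε) atTop (𝓝 0))
    {v : ℝ} (hv : 0 ≤ v) {p q : ℕ → ℝ} (hpq : ∀ᶠ n in atTop, (E n).quad (p n) (q n) = v) :
    Tendsto (fun n => ∫ ω, Complex.exp ((p n * (√(E n).W * ((E n).ρHat 1 ω - (E n).ρ 1))
        + q n * (√(E n).W * ((E n).ρHat 0 ω - (E n).ρ 0)) : ℝ) * Complex.I) ∂(E n).P)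
      atTop (𝓝 (Complex.exp (-(v : ℂ) / 2))) := by
  obtain ⟨c, hc, hoverlap⟩ := hoverlap
  obtain ⟨κ, hκ, hnondeg⟩ := hnondeg
  rw [tendsto_iff_norm_sub_tendsto_zero, Metric.tendsto_atTop']
  intro ε hε
  -- The expression is the limit in `n` of the error bound for fixed `η`. The constant `κ` may be
  -- negative, while the bound needs a nonnegative one, hence `max κ 0`.
  obtain ⟨η, hηε, hη0, hη1⟩ : ∃ η : ℝ, η * (v / (1 - max κ 0)) + (η * v + η ^ 2 * v) < ε ∧
      0 < η ∧ η ≤ 1 := by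
    have hlim : Tendsto (fun η : ℝ => η * (v / (1 - max κ 0)) + (η * v + η ^ 2 * v))
        (𝓝[>] 0) (𝓝 0) := by
      have : Continuous fun η : ℝ => η * (v / (1 - max κ 0)) + (η * v + η ^ 2 * v) := by fun_prop
      simpa using (this.tendsto 0).mono_left nhdsWithin_le_nhds
    exact ((hlim.eventually_lt_const hε).and
      (Ioc_mem_nhdsGT (zero_lt_one' ℝ))).exists
  have hL := hlindeberg (η ^ 2 / (v + 1)) (by positivity)
  have hK : Tendsto (fun n => ((E n).kishESS)⁻¹) atTop (𝓝 0) := tendsto_inv_atTop_zero.comp hKish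
  have hbound : Tendsto (fun n => η * (v / (1 - max κ 0))
      + (η⁻¹ + 8) * (4 / c ^ 2 * ((E n).kishESS)⁻¹)
      + (η * v + 4 * ((v + 1) * (E n).lindeberg (η ^ 2 / (v + 1)))
        + (η ^ 2 + (v + 1) * (E n).lindeberg (η ^ 2 / (v + 1))) * v)) atTop
      (𝓝 (η * (v / (1 - max κ 0)) + (η * v + η ^ 2 * v))) := by
    have h1 := ((hK.const_mul (4 / c ^ 2)).const_mul (η⁻¹ + 8)).const_add
      (η * (v / (1 - max κ 0)))
    have h2 := ((hL.const_mul (v + 1)).const_mul 4).const_add (η * v)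
    have h3 := ((hL.const_mul (v + 1)).const_add (η ^ 2)).mul_const v
    simpa using h1.add (h2.add h3)
  have hev : ∀ᶠ n in atTop, ‖∫ ω, Complex.exp ((p n * (√(E n).W * ((E n).ρHat 1 ω - (E n).ρ 1))
        + q n * (√(E n).W * ((E n).ρHat 0 ω - (E n).ρ 0)) : ℝ) * Complex.I) ∂(E n).P
        - Complex.exp (-(v : ℂ) / 2)‖ < ε := by
    filter_upwards [hbound.eventually_lt_const hηε, hB.eventually_gt_atTop 0, hoverlap, hnondeg,
      hpq] with n hn hBn hon hnn hpqn
    refine (norm_integral_exp_hajek_sub_le hBn hc (fun b z => (hon b z).1.le) (le_max_right κ 0)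
      (max_lt hκ one_pos) (hnn.2.trans ?_) hnn.1 hη0 hη1 hpqn).trans_lt hn
    gcongr
    exact le_max_left κ 0
  obtain ⟨N, hN⟩ := eventually_atTop.1 hev
  exact ⟨N, fun n hn => by simpa using hN n hn.le⟩

theorem charFun_map_standardizedθ (E : StratifiedExperiment) (t : EuclideanSpace ℝ (Fin 2)) :
    charFun (E.P.map E.standardizedθ) t = ∫ ω, Complex.exp
      (((E.SigmaInvSqrt *ᵥ t.ofLp) 0 * (√E.W * (E.ρHat 1 ω - E.ρ 1))
        + (E.SigmaInvSqrt *ᵥ t.ofLp) 1 * (√E.W * (E.ρHat 0 ω - E.ρ 0)) : ℝ) * Complex.I) ∂E.P := by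
  rw [charFun_apply, integral_map (Measurable.of_discrete).aemeasurable (by fun_prop)]
  simp only [inner_standardizedθ]

theorem charFun_map_standardizedτ (E : StratifiedExperiment) (t : ℝ) :
    charFun (E.P.map E.standardizedτ) t = ∫ ω, Complex.exp
      ((t * (√(E.quad 1 (-1)))⁻¹ * (√E.W * (E.ρHat 1 ω - E.ρ 1))
        + -(t * (√(E.quad 1 (-1)))⁻¹) * (√E.W * (E.ρHat 0 ω - E.ρ 0)) : ℝ) * Complex.I) ∂E.P := by
  have hq : E.sigmaSq 0 - 2 * E.sigma01 + E.sigmaSq 1 = E.quad 1 (-1) := by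
    unfold quad
    ring
  rw [charFun_apply_real, integral_map (Measurable.of_discrete).aemeasurable (by fun_prop)]
  congr 1 with ω
  rw [standardizedτ, hq, τHat, τ]
  congr 2
  rw [← Complex.ofReal_mul]
  congr 1
  ring

/-- The contrast variance is at least `2 λ_n`, so normalizing by its square root is legitimate. -/
theorem quad_contrast {E : StratifiedExperiment} (h : 0 < E.lambdaMin) (t : ℝ) :
    E.quad (t * (√(E.quad 1 (-1)))⁻¹) (-(t * (√(E.quad 1 (-1)))⁻¹)) = t ^ 2 := by
  have hpos : 0 < E.quad 1 (-1) := lt_of_lt_of_le (by positivity) (lambdaMin_mul_le_quad 1 (-1))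
  have hs : ∀ x : ℝ, E.quad x (-x) = x ^ 2 * E.quad 1 (-1) := fun x => by
    unfold quad
    ring
  rw [hs, mul_pow, inv_pow, Real.sq_sqrt hpos.le, mul_assoc, inv_mul_cancel₀ hpos.ne', mul_one]

end StratifiedExperiment

theorem mainTheorem1 (E : ℕ → StratifiedExperiment)
    -- the number of strata goes to infinity
    (hB : Tendsto (fun n => (E n).numStrata) atTop atTop)
    -- strong overlap
    (hoverlap : ∃ c : ℝ, 0 < c ∧ ∀ᶠ n in atTop, ∀ (b : Fin (E n).numStrata) (z : Fin 2),
      (E n).prob b z ∈ Set.Ioo c (1 - c))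
    -- Kish's effective sample size goes to infinity
    (hKish : Tendsto (fun n => (E n).kishESS) atTop atTop)
    -- asymptotic nondegeneracy of the covariance matrices
    (hnondeg : ∃ κ : ℝ, κ < 1 ∧ ∀ᶠ n in atTop, 0 < (E n).lambdaMin ∧
      |(E n).sigma01| ≤ κ * (√((E n).sigmaSq 0) * √((E n).sigmaSq 1)))
    -- Lindeberg condition
    (hlindeberg : ∀ ε : ℝ, 0 < ε → Tendsto (fun n => (E n).lindeberg ε) atTop (𝓝 0)) :
    TendstoInDistribution (fun n => (E n).standardizedθ) atTop
      (id : EuclideanSpace ℝ (Fin 2) → EuclideanSpace ℝ (Fin 2))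
      (fun n => (E n).P) (stdGaussian (EuclideanSpace ℝ (Fin 2))) ∧
    TendstoInDistribution (fun n => (E n).standardizedτ) atTop
      (id : ℝ → ℝ) (fun n => (E n).P) (gaussianReal 0 1) := by
  have hlim {v : ℝ} (hv : 0 ≤ v) {p q : ℕ → ℝ}
      (hpq : ∀ᶠ n in atTop, (E n).quad (p n) (q n) = v) :=
    StratifiedExperiment.tendsto_integral_exp_hajek E hB hoverlap hKish hnondeg hlindeberg hv hpq
  have hlam : ∀ᶠ n in atTop, 0 < (E n).lambdaMin := by
    obtain ⟨κ, -, h⟩ := hnondeg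
    exact h.mono fun n hn => hn.1
  refine ⟨⟨fun n => (Measurable.of_discrete).aemeasurable, aemeasurable_id, ?_⟩,
    ⟨fun n => (Measurable.of_discrete).aemeasurable, aemeasurable_id, ?_⟩⟩
  · refine ProbabilityMeasure.tendsto_iff_tendsto_charFun.2 fun t => ?_
    simp only [ProbabilityMeasure.coe_mk, Measure.map_id, charFun_stdGaussian,
      StratifiedExperiment.charFun_map_standardizedθ]
    have hnorm : t.ofLp ⬝ᵥ t.ofLp = ‖t‖ ^ 2 := by
      rw [EuclideanSpace.real_norm_sq_eq]
      simp [dotProduct, sq]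
    simpa using hlim (sq_nonneg ‖t‖) (hlam.mono fun n hn =>
      (StratifiedExperiment.quad_SigmaInvSqrt_mulVec hn t.ofLp).trans hnorm)
  · refine ProbabilityMeasure.tendsto_iff_tendsto_charFun.2 fun t => ?_
    simp only [ProbabilityMeasure.coe_mk, Measure.map_id, charFun_gaussianReal,
      StratifiedExperiment.charFun_map_standardizedτ]
    have := hlim (sq_nonneg t) (hlam.mono fun n hn => StratifiedExperiment.quad_contrast hn t)
    simpa [neg_div] using this
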